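/- Let $\mathbb H$ be a separable real or complex Hilbert space, let $n\ge 1$, and let $X_1,\dots,X_n$ be independent random compact self-adjoint operators on $\mathbb H$ with $\mathbb E X_i=0$ for all $i$ (that is, $\langle u,X_iv\rangle$ is integrable with mean $0$ for all $u,v\in\mathbb H$). Put $S_i=X_1+\dots+X_i$. For a self-adjoint operator $A$ let $\lambda_{\max}(A)$ be the largest point of its spectrum and $\|A\|$ its operator norm, and for $f:\mathbb R\to\mathbb R$ let $f(A)$ be defined through the spectral decomposition of $A$. Let $\phi(u)=e^u-u-1$ and $\varphi(u)=\cosh(u)-1$. Let $\theta_{\max}\in(0,\infty]$, $\psi:[0,\theta_{\max})\to\mathbb R$, $\sigma>0$, $d'\ge1$ and $r\in\mathbb R$. (a) If $$\mathbb E\,\mathrm{tr}\,\phi(\theta S_n)+d'\le d'\exp\bigl(\psi(|\theta|)\sigma^2\bigr)\qquad(*)$$ holds for all $\theta\in[0,\theta_{\max})$, then $$\mathbb P\Bigl(\sup_{1\le i\le n}\lambda_{\max}(S_i)\ge r\Bigr)\le\frac{e}{e-1}\,d'\inf_{\theta\in[0,\theta_{\max})}\exp\bigl(\psi(\theta)\sigma^2-\theta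 r\bigr).$$ (b) If $(*)$ holds for all $\theta\in(-\theta_{\max},\theta_{\max})$, or if $(*)$ with $\varphi$ in place of $\phi$ holds for all $\theta\in[0,\theta_{\max})$, then $$\mathbb P\Bigl(\sup_{1\le i\le n}\|S_i\|\ge r\Bigr)\le 2\,d'\inf_{\theta\in[0,\theta_{\max})}\exp\bigl(\psi(\theta)\sigma^2-\theta r\bigr).$$ -/

import Mathlib

open MeasureTheory ProbabilityTheory
open scoped ENNReal InnerProductSpace

noncomputable section

/-- The function `φ(u) = e ^ u - u - 1`. -/
def phi (u : ℝ) : ℝ := Real.exp u - u - 1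

/-- The function `ϕ(u) = cosh u - 1`. -/
def coshPhi (u : ℝ) : ℝ := Real.cosh u - 1

section Operators

variable {𝕜 H : Type*} [RCLike 𝕜] [NormedAddCommGroup H] [InnerProductSpace 𝕜 H]

/-- The largest point of the (real) spectrum of a self-adjoint operator. -/
def lambdaMax (A : H →L[𝕜] H) : ℝ := sSup {t : ℝ | (t : 𝕜) ∈ spectrum 𝕜 A}

variable [CompleteSpace H]

/-- The orthogonal projection onto the eigenspace of `A` for the real number `t`
(it is zero when `t` is not an eigenvalue). -/
def eigenProj (A : H →L[𝕜] H) (t : ℝ) : H →L[𝕜] H :=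
  (Module.End.eigenspace (A : Module.End 𝕜 H) (t : 𝕜)).starProjection

/-- The spectral reconstruction `f(A) = ∑ f(t) P_t` of a compact self-adjoint operator `A`, where
`t` runs through the eigenvalues of `A`, `P_t` is the orthogonal projection onto the eigenspace
for `t`, and the sum converges strongly, see `summable_spectralMap`. -/
def spectralMap (f : ℝ → ℝ) (A : H →L[𝕜] H) (x : H) : H :=
  ∑' t : ℝ, ((f t : ℝ) : 𝕜) • eigenProj A t x

variable (𝕜) in
/-- The trace `∑ ⟪e, T e⟫ ∈ [0, ∞]` of a positive operator `T`, where `e` runs through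
an orthonormal basis of the Hilbert space (the value does not depend on the basis,
since `T` is positive). -/
def posTrace (T : H → H) : ℝ≥0∞ :=
  ∑' e : (exists_hilbertBasis 𝕜 H).choose, ENNReal.ofReal (RCLike.re ⟪(e : H), T e⟫_𝕜)

lemma summable_spectralMap {f : ℝ → ℝ} (hf : Continuous f) {A : H →L[𝕜] H}
    (hA : IsSelfAdjoint A) (x : H) :
    Summable fun t : ℝ => ((f t : ℝ) : 𝕜) • eigenProj A t x := by
  have hsym : (A : H →ₗ[𝕜] H).IsSymmetric := hA.isSymmetric
  have hO : OrthogonalFamily 𝕜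
      (fun t : ℝ => Module.End.eigenspace (A : Module.End 𝕜 H) (t : 𝕜))
      (fun t : ℝ => (Module.End.eigenspace (A : Module.End 𝕜 H) (t : 𝕜)).subtypeₗᵢ) :=
    hsym.orthogonalFamily_eigenspaces.comp (γ := ℝ) RCLike.ofReal_injective
  have hmem : ∀ t : ℝ, eigenProj A t x ∈
      Module.End.eigenspace (A : Module.End 𝕜 H) (t : 𝕜) := fun t =>
    Submodule.starProjection_apply_mem _ x
  have hbes : ∀ s : Finset ℝ, ∑ t ∈ s, ‖eigenProj A t x‖ ^ 2 ≤ ‖x‖ ^ 2 := by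
    intro s
    have h1 : ‖∑ t ∈ s, eigenProj A t x‖ ^ 2 = ∑ t ∈ s, ‖eigenProj A t x‖ ^ 2 :=
      hO.norm_sum (fun t => ⟨eigenProj A t x, hmem t⟩) s
    have h2 : RCLike.re ⟪∑ t ∈ s, eigenProj A t x, x⟫_𝕜
        = ∑ t ∈ s, ‖eigenProj A t x‖ ^ 2 := by
      rw [sum_inner, map_sum]
      refine Finset.sum_congr rfl fun t _ => ?_
      exact Submodule.re_inner_starProjection_eq_normSq _ x
    have h3 := re_inner_le_norm (𝕜 := 𝕜) (∑ t ∈ s, eigenProj A t x) x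
    rw [h2, ← h1] at h3
    rw [← h1]
    nlinarith [norm_nonneg (∑ t ∈ s, eigenProj A t x), norm_nonneg x]
  obtain ⟨C, hC⟩ := (isCompact_Icc (a := -‖A‖) (b := ‖A‖)).exists_bound_of_continuousOn
    hf.continuousOn
  have hle : ∀ t : ℝ, ‖((f t : ℝ) : 𝕜) • eigenProj A t x‖ ^ 2
      ≤ C ^ 2 * ‖eigenProj A t x‖ ^ 2 := by
    intro t
    by_cases h0 : eigenProj A t x = 0
    · simp [h0]
    have hAt : A (eigenProj A t x) = (t : 𝕜) • eigenProj A t x :=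
      Module.End.mem_eigenspace_iff.1 (hmem t)
    have h4 : |t| * ‖eigenProj A t x‖ ≤ ‖A‖ * ‖eigenProj A t x‖ := by
      have := A.le_opNorm (eigenProj A t x)
      rwa [hAt, norm_smul, RCLike.norm_ofReal] at this
    have h5 : |t| ≤ ‖A‖ := le_of_mul_le_mul_right h4 (norm_pos_iff.2 h0)
    have h6 := hC t (abs_le.1 h5)
    rw [norm_smul, RCLike.norm_ofReal, mul_pow]
    rw [Real.norm_eq_abs] at h6
    gcongr
  have := (hO.summable_iff_norm_sq_summable
    (fun t => ((f t : ℝ) : 𝕜) • ⟨eigenProj A t x, hmem t⟩)).2 ?_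
  · exact this
  · refine Summable.of_nonneg_of_le (fun _ => sq_nonneg _) hle (Summable.mul_left _ ?_)
    exact summable_of_sum_le (fun _ => sq_nonneg _) hbes

end Operators

section RandomOperators

variable {𝕜 H Ω : Type*} [RCLike 𝕜] [NormedAddCommGroup H] [InnerProductSpace 𝕜 H]
  [MeasurableSpace Ω]

/-- The random operator `X` has expectation zero: all its matrix entries are integrable
with mean zero. This is implied by Bochner integrability of `X` with integral zero. -/
def IsCentered (μ : Measure Ω) (X : Ω → H →L[𝕜] H) : Prop :=
  ∀ u v : H, Integrable (fun ω => ⟪u, X ω v⟫_𝕜) μ ∧ ∫ ω, ⟪u, X ω v⟫_𝕜 ∂μ = 0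

/-- The partial sum `∑ X_j` over all `j ≤ i`. -/
def partialSum {n : ℕ} (X : Fin n → Ω → H →L[𝕜] H) (i : Fin n) (ω : Ω) : H →L[𝕜] H :=
  ∑ j ∈ Finset.Iic i, X j ω

variable [CompleteSpace H]

/-- The inequality `E tr f(θ S) + d' ≤ d' exp(ψ(|θ|) σ²)` in `[0, ∞]`, for a nonnegative `f`. -/
def TraceBound (μ : Measure Ω) (f : ℝ → ℝ) (S : Ω → H →L[𝕜] H) (ψ : ℝ → ℝ) (σ d' θ : ℝ) : Prop :=
  ∫⁻ ω, posTrace 𝕜 (spectralMap f ((θ : 𝕜) • S ω)) ∂μ + ENNReal.ofReal d'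
    ≤ ENNReal.ofReal (d' * Real.exp (ψ |θ| * σ ^ 2))

end RandomOperators

end

/-! ### Spectral resolution and lower bounds for the trace -/

section Spectral

variable {𝕜 H : Type*} [RCLike 𝕜] [NormedAddCommGroup H] [InnerProductSpace 𝕜 H] [CompleteSpace H]

/-! Kolmogorov's maximal inequality is run on the scalar sums ⟨u, S_i u⟩, with u in a countable
dense set of unit vectors. Let θ > 0 and 0 < x < r. If λ_max(S_i) ≥ r, then ⟨u, S_i u⟩ ≥ x for some
such u. Split this event according to the first pair (i, u), ordered by time first, at which the
level x is reached. Each part depends only on X_1, …, X_i, so ⟨u, (S_n - S_i)u⟩ integrates to zero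
over it (`exists_firstPassage_weights`).

The numbers ‖P_t u‖² over the eigenprojections of S_n sum to 1. Hence tr φ(θS_n) ≥ ⟨u, φ(θS_n)u⟩ is
at least the tangent of φ at θx, evaluated at θ⟨u, S_n u⟩ (`ofReal_affine_le_posTrace`). Integrating
this over a part gives at least φ(θx) times its probability. Summing over the disjoint parts and
letting x → r bounds φ(θr) ℙ(event) by E tr φ(θS_n), hence by d'(exp(ψσ²) - 1).

For the norm, both signs ±⟨u, S_i u⟩ are followed, and φ(u) + φ(-u) = 2(cosh u - 1) combines the
bounds at θ and -θ. Elementary estimates, `le_mul_exp_of_phi_mul_le` and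
`le_mul_exp_of_coshPhi_mul_le`, then produce the constants e/(e-1) and 2. -/

lemma apply_eigenProj (A : H →L[𝕜] H) (t : ℝ) (x : H) :
    A (eigenProj A t x) = (t : 𝕜) • eigenProj A t x :=
  Module.End.mem_eigenspace_iff.1 (Submodule.starProjection_apply_mem
    (Module.End.eigenspace (A : Module.End 𝕜 H) (t : 𝕜)) x)

lemma re_inner_eigenProj (A : H →L[𝕜] H) (t : ℝ) (x : H) :
    RCLike.re ⟪x, eigenProj A t x⟫_𝕜 = ‖eigenProj A t x‖ ^ 2 := by
  rw [inner_re_symm]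
  exact Submodule.re_inner_starProjection_eq_normSq _ x

/-- A compact self-adjoint operator resolves the identity into its eigenprojections. -/
lemma hasSum_eigenProj {A : H →L[𝕜] H} (hA : IsSelfAdjoint A) (hc : IsCompactOperator A) (x : H) :
    HasSum (fun t : ℝ => eigenProj A t x) x := by
  have hsym : (A : H →ₗ[𝕜] H).IsSymmetric := hA.isSymmetric
  have hs : Summable fun t : ℝ => eigenProj A t x := by
    simpa using summable_spectralMap (f := fun _ => 1) continuous_const hA x
  -- The remainder is orthogonal to every eigenspace, and for a compact self-adjoint operator the
  -- eigenspaces span a dense subspace.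
  have horth : ∀ (μ : 𝕜), ∀ v ∈ Module.End.eigenspace (A : Module.End 𝕜 H) μ,
      ⟪v, x - ∑' t : ℝ, eigenProj A t x⟫_𝕜 = 0 := by
    intro μ v hv
    by_cases hv0 : v = 0
    · simp [hv0]
    have hμ : Module.End.HasEigenvalue (A : Module.End 𝕜 H) μ :=
      Module.End.hasEigenvalue_of_hasEigenvector ⟨hv, hv0⟩
    obtain ⟨s, rfl⟩ : ∃ s : ℝ, (s : 𝕜) = μ :=
      RCLike.conj_eq_iff_real.1 (hsym.conj_eigenvalue_eq_self hμ) |>.imp fun _ h => h.symm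
    have h1 : HasSum (fun t : ℝ => ⟪v, eigenProj A t x⟫_𝕜) ⟪v, ∑' t : ℝ, eigenProj A t x⟫_𝕜 :=
      hs.hasSum.mapL (innerSL 𝕜 v)
    have h2 : ∀ t : ℝ, t ≠ s → ⟪v, eigenProj A t x⟫_𝕜 = 0 := fun t ht =>
      hsym.orthogonalFamily_eigenspaces (i := (s : 𝕜)) (j := (t : 𝕜))
        (fun h => ht (RCLike.ofReal_injective h).symm) ⟨v, hv⟩
        ⟨_, Submodule.starProjection_apply_mem _ x⟩
    have h3 := h1.unique (hasSum_single s h2)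
    have h4 : ⟪v, eigenProj A s x⟫_𝕜 = ⟪v, x⟫_𝕜 := by
      rw [eigenProj, ← Submodule.inner_starProjection_left_eq_right,
        Submodule.starProjection_eq_self_iff.2 hv]
    rw [inner_sub_right, h3, h4, sub_self]
  have hmem : x - ∑' t : ℝ, eigenProj A t x ∈
      (⨆ μ, Module.End.eigenspace (A : Module.End 𝕜 H) μ)ᗮ := by
    rw [Submodule.mem_orthogonal]
    intro u hu
    induction hu using Submodule.iSup_induction' with
    | mem μ v hv => exact horth μ v hv
    | zero => simp
    | add v w _ _ hv hw => rw [inner_add_left, hv, hw, add_zero]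
  rw [ContinuousLinearMap.orthogonalComplement_iSup_eigenspaces_eq_bot hc hsym,
    Submodule.mem_bot, sub_eq_zero] at hmem
  have := hs.hasSum
  rwa [← hmem] at this

lemma hasSum_norm_sq_eigenProj {A : H →L[𝕜] H} (hA : IsSelfAdjoint A)
    (hc : IsCompactOperator A) (x : H) :
    HasSum (fun t : ℝ => ‖eigenProj A t x‖ ^ 2) (‖x‖ ^ 2) := by
  have h := ((hasSum_eigenProj hA hc x).mapL (innerSL 𝕜 x)).mapL (RCLike.reCLM (K := 𝕜))
  simpa [re_inner_eigenProj] using h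

lemma hasSum_re_inner_apply_self {A : H →L[𝕜] H} (hA : IsSelfAdjoint A)
    (hc : IsCompactOperator A) (x : H) :
    HasSum (fun t : ℝ => t * ‖eigenProj A t x‖ ^ 2) (RCLike.re ⟪x, A x⟫_𝕜) := by
  have h := (((hasSum_eigenProj hA hc x).mapL A).mapL (innerSL 𝕜 x)).mapL (RCLike.reCLM (K := 𝕜))
  simpa [apply_eigenProj, inner_smul_right, RCLike.re_ofReal_mul, re_inner_eigenProj] using h

lemma hasSum_re_inner_spectralMap {f : ℝ → ℝ} (hf : Continuous f) {A : H →L[𝕜] H}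
    (hA : IsSelfAdjoint A) (x : H) :
    HasSum (fun t : ℝ => f t * ‖eigenProj A t x‖ ^ 2) (RCLike.re ⟪x, spectralMap f A x⟫_𝕜) := by
  have h := ((summable_spectralMap hf hA x).hasSum.mapL (innerSL 𝕜 x)).mapL
    (RCLike.reCLM (K := 𝕜))
  simpa [spectralMap, inner_smul_right, RCLike.re_ofReal_mul, re_inner_eigenProj] using h

lemma ofReal_re_inner_spectralMap {f : ℝ → ℝ} (hf : Continuous f) (hf0 : ∀ t, 0 ≤ f t)
    {A : H →L[𝕜] H} (hA : IsSelfAdjoint A) (x : H) :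
    ENNReal.ofReal (RCLike.re ⟪x, spectralMap f A x⟫_𝕜)
      = ∑' t : ℝ, ENNReal.ofReal (f t) * ENNReal.ofReal (‖eigenProj A t x‖ ^ 2) := by
  have h := hasSum_re_inner_spectralMap hf hA x
  rw [← h.tsum_eq, ENNReal.ofReal_tsum_of_nonneg
    (fun t => mul_nonneg (hf0 t) (sq_nonneg _)) h.summable]
  exact tsum_congr fun t => ENNReal.ofReal_mul (hf0 t)

/-- The quadratic form of a projection at a unit vector is bounded by its trace. -/
lemma ofReal_norm_sq_eigenProj_le {ι : Type*} (b : HilbertBasis ι 𝕜 H) (A : H →L[𝕜] H) (t : ℝ)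
    {u : H} (hu : ‖u‖ = 1) :
    ENNReal.ofReal (‖eigenProj A t u‖ ^ 2)
      ≤ ∑' e : ι, ENNReal.ofReal (‖eigenProj A t (b e)‖ ^ 2) := by
  have h := (b.hasSum_inner_mul_inner (eigenProj A t u) (eigenProj A t u)).mapL
    (RCLike.reCLM (K := 𝕜))
  have h' : HasSum (fun e : ι => ‖⟪b e, eigenProj A t u⟫_𝕜‖ ^ 2) (‖eigenProj A t u‖ ^ 2) := by
    have hterm : ∀ e : ι, RCLike.reCLM (K := 𝕜)
        (⟪eigenProj A t u, b e⟫_𝕜 * ⟪b e, eigenProj A t u⟫_𝕜)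
          = ‖⟪b e, eigenProj A t u⟫_𝕜‖ ^ 2 := fun e => by
      rw [← inner_conj_symm (eigenProj A t u) (b e), RCLike.conj_mul, ← RCLike.ofReal_pow,
        RCLike.reCLM_apply, RCLike.ofReal_re]
    simp only [hterm] at h
    rwa [RCLike.reCLM_apply, inner_self_eq_norm_sq] at h
  rw [← h'.tsum_eq, ENNReal.ofReal_tsum_of_nonneg (fun _ => sq_nonneg _) h'.summable]
  refine ENNReal.tsum_le_tsum fun e => ENNReal.ofReal_le_ofReal ?_
  have h1 : ⟪b e, eigenProj A t u⟫_𝕜 = ⟪eigenProj A t (b e), u⟫_𝕜 :=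
    (Submodule.inner_starProjection_left_eq_right _ _ _).symm
  rw [h1]
  have h2 := norm_inner_le_norm (𝕜 := 𝕜) (eigenProj A t (b e)) u
  rw [hu, mul_one] at h2
  gcongr

/-- The quadratic form of `f(A)` at a unit vector is bounded by the trace of `f(A)`. -/
lemma ofReal_re_inner_spectralMap_le_posTrace {f : ℝ → ℝ} (hf : Continuous f)
    (hf0 : ∀ t, 0 ≤ f t) {A : H →L[𝕜] H} (hA : IsSelfAdjoint A) {u : H} (hu : ‖u‖ = 1) :
    ENNReal.ofReal (RCLike.re ⟪u, spectralMap f A u⟫_𝕜) ≤ posTrace 𝕜 (spectralMap f A) := by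
  obtain ⟨b, hb⟩ := (exists_hilbertBasis 𝕜 H).choose_spec
  have hbe : ∀ e, b e = (e : H) := fun e => congrFun hb e
  rw [posTrace, ofReal_re_inner_spectralMap hf hf0 hA]
  simp_rw [ofReal_re_inner_spectralMap hf hf0 hA]
  -- Exchanging the sums turns the trace into ∑ f(t) tr P_t, which is compared eigenvalue by
  -- eigenvalue.
  rw [ENNReal.tsum_comm]
  refine ENNReal.tsum_le_tsum fun t => ?_
  rw [ENNReal.tsum_mul_left]
  gcongr
  simpa only [hbe] using ofReal_norm_sq_eigenProj_le b A t hu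

/-- An affine minorant of `f` yields an affine lower bound for `tr f(A)`. -/
lemma ofReal_affine_le_posTrace {f : ℝ → ℝ} (hf : Continuous f)
    (hf0 : ∀ t, 0 ≤ f t) {A : H →L[𝕜] H} (hA : IsSelfAdjoint A) (hc : IsCompactOperator A)
    {a c : ℝ} (hac : ∀ t, a + c * t ≤ f t) {u : H} (hu : ‖u‖ = 1) :
    ENNReal.ofReal (a + c * RCLike.re ⟪u, A u⟫_𝕜) ≤ posTrace 𝕜 (spectralMap f A) := by
  refine le_trans (ENNReal.ofReal_le_ofReal ?_)
    (ofReal_re_inner_spectralMap_le_posTrace hf hf0 hA hu)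
  have h1 := ((hasSum_norm_sq_eigenProj hA hc u).mul_left a).add
    ((hasSum_re_inner_apply_self hA hc u).mul_left c)
  rw [hu, one_pow, mul_one] at h1
  refine hasSum_le (fun t => ?_) h1 (hasSum_re_inner_spectralMap hf hA u)
  have := mul_le_mul_of_nonneg_right (hac t) (sq_nonneg ‖eigenProj A t u‖)
  linarith

end Spectral

/-! ### Unit vectors detecting the spectrum and the norm -/

section Rayleigh

variable {𝕜 H : Type*} [RCLike 𝕜] [NormedAddCommGroup H] [InnerProductSpace 𝕜 H]

lemma exists_lt_re_inner_of_le_lambdaMax [CompleteSpace H] {A : H →L[𝕜] H}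
    (hc : IsCompactOperator A) {x r : ℝ} (hx : 0 ≤ x) (hxr : x < r) (hr : r ≤ lambdaMax A) :
    ∃ u : H, ‖u‖ = 1 ∧ x < RCLike.re ⟪u, A u⟫_𝕜 := by
  have hne : {t : ℝ | (t : 𝕜) ∈ spectrum 𝕜 A}.Nonempty := by
    -- An empty supremum has the value 0, which is excluded by r > 0.
    by_contra h
    rw [Set.not_nonempty_iff_eq_empty] at h
    rw [lambdaMax, h, Real.sSup_empty] at hr
    linarith
  obtain ⟨t, ht, hxt⟩ := exists_lt_of_lt_csSup hne (hxr.trans_le hr)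
  have ht0 : (t : 𝕜) ≠ 0 := RCLike.ofReal_ne_zero.2 (hx.trans_lt hxt).ne'
  obtain ⟨v, hv⟩ := ((hc.hasEigenvalue_iff_mem_spectrum ht0).2 ht).exists_hasEigenvector
  have hv0 : ‖v‖ ≠ 0 := norm_ne_zero_iff.2 hv.2
  have hAv : A v = (t : 𝕜) • v := Module.End.mem_eigenspace_iff.1 hv.1
  refine ⟨((‖v‖⁻¹ : ℝ) : 𝕜) • v, by simp [norm_smul, hv0], ?_⟩
  have h1 : ‖((‖v‖⁻¹ : ℝ) : 𝕜) • v‖ = 1 := by simp [norm_smul, hv0]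
  rw [map_smul, hAv, smul_comm, inner_smul_right, inner_self_eq_norm_sq_to_K, h1]
  simpa using hxt

/-- The norm of a symmetric operator is the supremum of the absolute Rayleigh quotient, which is
unchanged by rescaling to the unit sphere. -/
lemma exists_lt_abs_re_inner_of_le_norm {A : H →L[𝕜] H}
    (hA : (A : H →ₗ[𝕜] H).IsSymmetric) {x r : ℝ} (hx : 0 ≤ x) (hxr : x < r) (hr : r ≤ ‖A‖) :
    ∃ u : H, ‖u‖ = 1 ∧ x < |RCLike.re ⟪u, A u⟫_𝕜| := by
  rw [A.norm_eq_iSup_rayleighQuotient hA] at hr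
  obtain ⟨v, hv⟩ := exists_lt_of_lt_ciSup (hxr.trans_le hr)
  have hv0 : v ≠ 0 := by
    rintro rfl
    simp at hv
    linarith
  have hmem : A.rayleighQuotient v ∈ A.rayleighQuotient '' Metric.sphere 0 1 := by
    rw [← A.image_rayleigh_eq_image_rayleigh_sphere one_pos]
    exact ⟨v, hv0, rfl⟩
  obtain ⟨u, hu, huv⟩ := hmem
  rw [mem_sphere_zero_iff_norm] at hu
  refine ⟨u, hu, ?_⟩
  rw [← huv, ContinuousLinearMap.rayleighQuotient, ContinuousLinearMap.reApplyInnerSelf_apply,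
    hu, inner_re_symm] at hv
  simpa using hv

lemma continuous_re_inner_apply_self (A : H →L[𝕜] H) :
    Continuous fun u : H => RCLike.re ⟪u, A u⟫_𝕜 := by fun_prop

end Rayleigh

/-! ### Kolmogorov's first passage argument -/

section FirstPassage

lemma ofReal_integral_le_lintegral_ofReal {α : Type*} [MeasurableSpace α] {μ : Measure α}
    {f : α → ℝ} (hf : Integrable f μ) :
    ENNReal.ofReal (∫ x, f x ∂μ) ≤ ∫⁻ x, ENNReal.ofReal (f x) ∂μ := by
  have h := ofReal_integral_eq_lintegral_ofReal (f := fun x => max (f x) 0) hf.pos_part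
    (Filter.Eventually.of_forall fun _ => le_max_right _ _)
  simp only [ENNReal.ofReal_max, ENNReal.ofReal_zero, zero_le, max_eq_left] at h
  rw [← h]
  exact ENNReal.ofReal_le_ofReal (integral_mono hf hf.pos_part fun _ => le_max_left _ _)

variable {Ω E K : Type*} [MeasurableSpace Ω] [MeasurableSpace E] {μ : Measure Ω}

/-- On an event depending only on the first summands, the later summands have integral zero. -/
lemma setIntegral_comp_eq_zero {ι : Type*} {X : ι → Ω → E} (hX : ∀ i, Measurable (X i))
    (hind : iIndepFun X μ) {S : Set ι} {j : ι} (hj : j ∉ S) {C : Set Ω}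
    (hC : MeasurableSet[⨆ l ∈ S, MeasurableSpace.comap (X l) inferInstance] C)
    {y : E → ℝ} (hy : Measurable y) (h0 : ∫ ω, y (X j ω) ∂μ = 0) :
    ∫ ω in C, y (X j ω) ∂μ = 0 := by
  have hm : ∀ l, MeasurableSpace.comap (X l) inferInstance ≤ ‹MeasurableSpace Ω› :=
    fun l => (hX l).comap_le
  have hI : Indep (⨆ l ∈ S, MeasurableSpace.comap (X l) inferInstance)
      (MeasurableSpace.comap (X j) inferInstance) μ := by
    have := indep_iSup_of_disjoint hm hind.iIndep (Set.disjoint_singleton_right.2 hj)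
    simpa using this
  rw [hI.setIntegral_eq_mul (iSup₂_le fun l _ => hm l) (hX j).aemeasurable hC
    hy.aestronglyMeasurable, h0, mul_zero]

/-- Kolmogorov's argument for a countable family of sums of independent centered variables,
indexed by `k`: the event that one of the partial sums reaches the level `x` splits into parts
of mass `w k`, and any `g` that dominates `a k + c k * (Z k - x)`, with `Z k` the full sum,
has integral at least `∑ a k * w k`. -/
lemma exists_firstPassage_weights [IsProbabilityMeasure μ] [Countable K] {n : ℕ}
    {X : Fin n → Ω → E} (hX : ∀ i, Measurable (X i)) (hind : iIndepFun X μ)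
    {y : K → E → ℝ} (hy : ∀ k, Measurable (y k))
    (hint : ∀ k i, Integrable (fun ω => y k (X i ω)) μ)
    (hzero : ∀ k i, ∫ ω, y k (X i ω) ∂μ = 0) (x : ℝ) :
    ∃ w : K → ℝ≥0∞,
      ∑' k, w k = μ {ω | ∃ i k, x ≤ ∑ j ∈ Finset.Iic i, y k (X j ω)} ∧
      ∀ (a c : K → ℝ) (g : Ω → ℝ≥0∞), (∀ k, 0 ≤ c k) →
        (∀ k, ∀ᵐ ω ∂μ, ENNReal.ofReal (a k + c k * (∑ i, y k (X i ω) - x)) ≤ g ω) →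
        ∑' k, ENNReal.ofReal (a k) * w k ≤ ∫⁻ ω, g ω ∂μ := by
  classical
  have := Encodable.ofCountable K
  -- Time comes first in the lexicographic order, so everything preceding (i, k) is known at time i.
  -- The order is well-founded even for infinite `K`.
  set ρ : Fin n × K → Fin n ×ₗ ℕ := fun p => toLex (p.1, Encodable.encode p.2) with hρ
  have hρinj : Function.Injective ρ := by
    rintro ⟨i, k⟩ ⟨j, l⟩ h
    simpa [hρ] using h
  set Z : Fin n × K → Ω → ℝ := fun p ω => ∑ j ∈ Finset.Iic p.1, y p.2 (X j ω) with hZ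
  set C : Fin n × K → Set Ω :=
    fun p => Z p ⁻¹' Set.Ici x ∩ ⋂ q : Fin n × K, ⋂ _ : ρ q < ρ p, Z q ⁻¹' Set.Iio x with hCdef
  set F : Fin n → MeasurableSpace Ω :=
    fun i => ⨆ l ∈ Set.Iic i, MeasurableSpace.comap (X l) inferInstance with hF
  have hFle : ∀ i, F i ≤ ‹MeasurableSpace Ω› := fun i => iSup₂_le fun l _ => (hX l).comap_le
  have hZm : ∀ (i : Fin n) (q : Fin n × K), q.1 ≤ i → Measurable[F i] (Z q) := by
    intro i q hq
    refine Finset.measurable_sum _ fun j hj => ?_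
    have h1 : Measurable[F i] (X j) :=
      Measurable.mono (comap_measurable (X j))
        (le_iSup₂_of_le j ((Finset.mem_Iic.1 hj).trans hq) le_rfl) le_rfl
    exact (hy q.2).comp h1
  have hCm : ∀ p, MeasurableSet[F p.1] (C p) := by
    intro p
    refine MeasurableSet.inter (hZm _ p le_rfl measurableSet_Ici) ?_
    refine MeasurableSet.iInter fun q => MeasurableSet.iInter fun hq => ?_
    refine hZm _ q ?_ measurableSet_Iio
    rw [hρ, Prod.Lex.toLex_lt_toLex] at hq
    rcases hq with hq | hq
    · exact hq.le
    · exact hq.1.le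
  have hCm' : ∀ p, MeasurableSet (C p) := fun p => hFle _ _ (hCm p)
  have hdisj : Pairwise (Function.onFun Disjoint C) := by
    have key : ∀ p q, ρ p < ρ q → Disjoint (C p) (C q) := by
      intro p q h
      rw [Set.disjoint_left]
      rintro ω ⟨hp, -⟩ ⟨-, hq⟩
      simp only [Set.mem_iInter] at hq
      exact not_le.2 (show Z p ω < x from hq p h) (show x ≤ Z p ω from hp)
    intro p q hpq
    rcases lt_or_gt_of_ne (hρinj.ne hpq) with h | h
    · exact key p q h
    · exact (key q p h).symm
  have hunion : {ω | ∃ i k, x ≤ ∑ j ∈ Finset.Iic i, y k (X j ω)} = ⋃ p, C p := by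
    ext ω
    simp only [Set.mem_ofPred_eq, Set.mem_iUnion]
    constructor
    · rintro ⟨i, k, h⟩
      obtain ⟨p, hp, hmin⟩ := (InvImage.wf ρ (wellFounded_lt)).has_min
        {p : Fin n × K | x ≤ Z p ω} ⟨(i, k), h⟩
      refine ⟨p, hp, ?_⟩
      simp only [Set.mem_iInter]
      intro q hq
      exact lt_of_not_ge fun hle : x ≤ Z q ω => hmin q hle hq
    · rintro ⟨p, hp, -⟩
      exact ⟨p.1, p.2, hp⟩
  refine ⟨fun k => ∑' i, μ (C (i, k)), ?_, ?_⟩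
  · rw [hunion, measure_iUnion hdisj hCm', ENNReal.tsum_comm]
    exact (ENNReal.tsum_prod (f := fun i k => μ (C (i, k)))).symm
  -- The weights are already fixed, so one decomposition serves several choices of `g`. No
  -- measurability of `g` is needed, because the parts are measurable and disjoint.
  · intro a c g hc hg
    have hpart : ∀ p, ENNReal.ofReal (a p.2) * μ (C p) ≤ ∫⁻ ω in C p, g ω ∂μ := by
      rintro ⟨i, k⟩
      have hintS : Integrable (fun ω => ∑ j, y k (X j ω)) μ :=
        integrable_finsetSum _ fun j _ => hint k j
      have hintI : Integrable (fun ω => ∑ j ∈ Finset.Iic i, y k (X j ω)) μ :=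
        integrable_finsetSum _ fun j _ => hint k j
      have hinth : Integrable (fun ω => a k + c k * (∑ j, y k (X j ω) - x)) μ :=
        (integrable_const _).add ((hintS.sub (integrable_const _)).const_mul _)
      have hintl : Integrable
          (fun ω => a k + c k * (∑ j ∈ Finset.Iic i, y k (X j ω) - x)) μ :=
        (integrable_const _).add ((hintI.sub (integrable_const _)).const_mul _)
      have hrest : ∫ ω in C (i, k), (∑ j, y k (X j ω)) ∂μ
          = ∫ ω in C (i, k), (∑ j ∈ Finset.Iic i, y k (X j ω)) ∂μ := by
        rw [integral_finsetSum _ fun j _ => (hint k j).integrableOn,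
          integral_finsetSum _ fun j _ => (hint k j).integrableOn]
        refine (Finset.sum_subset (Finset.subset_univ _) fun j _ hj => ?_).symm
        exact setIntegral_comp_eq_zero hX hind (S := Set.Iic i)
          (fun h => hj (Finset.mem_Iic.2 h)) (hCm (i, k)) (hy k) (hzero k j)
      have haff : ∀ Y : Ω → ℝ, Integrable Y μ → ∫ ω in C (i, k), (a k + c k * (Y ω - x)) ∂μ
          = μ.real (C (i, k)) * a k
            + c k * (∫ ω in C (i, k), Y ω ∂μ - μ.real (C (i, k)) * x) := by
        intro Y hY
        have hYx : Integrable (fun ω => Y ω - x) (μ.restrict (C (i, k))) :=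
          hY.integrableOn.sub (integrable_const _)
        rw [integral_add (integrable_const _) (hYx.const_mul _),
          integral_const_mul, integral_sub hY.integrableOn (integrable_const _)]
        simp
      have hlow : a k * μ.real (C (i, k))
          ≤ ∫ ω in C (i, k), (a k + c k * (∑ j, y k (X j ω) - x)) ∂μ := by
        rw [haff _ hintS, hrest, ← haff _ hintI]
        refine setIntegral_ge_of_const_le_real (hCm' _) (measure_ne_top _ _) (fun ω hω => ?_)
          hintl.integrableOn
        have : x ≤ ∑ j ∈ Finset.Iic i, y k (X j ω) := hω.1
        nlinarith [mul_nonneg (hc k) (sub_nonneg.2 this)]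
      calc ENNReal.ofReal (a k) * μ (C (i, k))
          = ENNReal.ofReal (a k * μ.real (C (i, k))) := by
            rw [ENNReal.ofReal_mul' measureReal_nonneg, ofReal_measureReal]
        _ ≤ ENNReal.ofReal (∫ ω in C (i, k), (a k + c k * (∑ j, y k (X j ω) - x)) ∂μ) :=
            ENNReal.ofReal_le_ofReal hlow
        _ ≤ ∫⁻ ω in C (i, k), ENNReal.ofReal (a k + c k * (∑ j, y k (X j ω) - x)) ∂μ :=
            ofReal_integral_le_lintegral_ofReal hinth.integrableOn
        _ ≤ ∫⁻ ω in C (i, k), g ω ∂μ := lintegral_mono_ae (ae_restrict_of_ae (hg k))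
    calc ∑' k, ENNReal.ofReal (a k) * ∑' i, μ (C (i, k))
        = ∑' p : Fin n × K, ENNReal.ofReal (a p.2) * μ (C p) := by
          simp_rw [← ENNReal.tsum_mul_left]
          rw [ENNReal.tsum_comm]
          exact (ENNReal.tsum_prod (f := fun i k => ENNReal.ofReal (a k) * μ (C (i, k)))).symm
      _ ≤ ∑' p, ∫⁻ ω in C p, g ω ∂μ := ENNReal.tsum_le_tsum hpart
      _ = ∫⁻ ω in ⋃ p, C p, g ω ∂μ := (lintegral_iUnion hCm' hdisj g).symm
      _ ≤ ∫⁻ ω, g ω ∂μ := setLIntegral_le_lintegral _ _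

/-- Outside a null set all the finitely many summands agree with measurable versions, and these
remain independent. -/
lemma exists_firstPassage_weights_of_aemeasurable [IsProbabilityMeasure μ] [Countable K] {n : ℕ}
    {X : Fin n → Ω → E} (hX : ∀ i, AEMeasurable (X i) μ) (hind : iIndepFun X μ)
    {y : K → E → ℝ} (hy : ∀ k, Measurable (y k))
    (hint : ∀ k i, Integrable (fun ω => y k (X i ω)) μ)
    (hzero : ∀ k i, ∫ ω, y k (X i ω) ∂μ = 0) (x : ℝ) :
    ∃ w : K → ℝ≥0∞,
      ∑' k, w k = μ {ω | ∃ i k, x ≤ ∑ j ∈ Finset.Iic i, y k (X j ω)} ∧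
      ∀ (a c : K → ℝ) (g : Ω → ℝ≥0∞), (∀ k, 0 ≤ c k) →
        (∀ k, ∀ᵐ ω ∂μ, ENNReal.ofReal (a k + c k * (∑ i, y k (X i ω) - x)) ≤ g ω) →
        ∑' k, ENNReal.ofReal (a k) * w k ≤ ∫⁻ ω, g ω ∂μ := by
  have hmk : ∀ i, X i =ᵐ[μ] (hX i).mk := fun i => (hX i).ae_eq_mk
  have hcomp : ∀ k i, (fun ω => y k (X i ω)) =ᵐ[μ] fun ω => y k ((hX i).mk (X i) ω) := by
    intro k i
    filter_upwards [hmk i] with ω h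
    rw [h]
  have hall : ∀ᵐ ω ∂μ, ∀ i, X i ω = (hX i).mk (X i) ω := ae_all_iff.2 hmk
  obtain ⟨w, hw, hbound⟩ := exists_firstPassage_weights (fun i => (hX i).measurable_mk)
    (hind.congr hmk) hy (fun k i => (hint k i).congr (hcomp k i))
    (fun k i => (integral_congr_ae (hcomp k i)).symm.trans (hzero k i)) x
  refine ⟨w, hw.trans (measure_congr ?_), fun a c g hc hg => hbound a c g hc fun k => ?_⟩
  · filter_upwards [hall] with ω h
    simp only [← h, Set.ofPred]
  · filter_upwards [hall, hg k] with ω h h'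
    simpa only [← h] using h'

end FirstPassage

/-! ### Convexity of φ and cosh - 1, and passage to the limit -/

section Convex

lemma phi_tangent (x t : ℝ) : phi x + (Real.exp x - 1) * (t - x) ≤ phi t := by
  have h := Real.add_one_le_exp (t - x)
  have h2 := mul_le_mul_of_nonneg_left h (Real.exp_pos x).le
  rw [← Real.exp_add, add_sub_cancel] at h2
  unfold phi
  linarith

lemma phi_nonneg (t : ℝ) : 0 ≤ phi t := by
  have := Real.add_one_le_exp t
  unfold phi
  linarith

lemma continuous_phi : Continuous phi := by
  unfold phi
  fun_prop

lemma phi_add_phi_neg (t : ℝ) : phi t + phi (-t) = 2 * coshPhi t := by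
  rw [phi, phi, coshPhi, Real.cosh_eq]
  ring

lemma coshPhi_tangent (x t : ℝ) : coshPhi x + Real.sinh x * (t - x) ≤ coshPhi t := by
  have h1 := phi_tangent x t
  have h2 := phi_tangent (-x) (-t)
  have h3 := phi_add_phi_neg x
  have h4 := phi_add_phi_neg t
  rw [Real.sinh_eq]
  linarith

lemma coshPhi_nonneg (t : ℝ) : 0 ≤ coshPhi t := sub_nonneg.2 (Real.one_le_cosh t)

lemma continuous_coshPhi : Continuous coshPhi := by
  unfold coshPhi
  fun_prop

lemma coshPhi_neg (t : ℝ) : coshPhi (-t) = coshPhi t := by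
  rw [coshPhi, Real.cosh_neg, coshPhi]

lemma exists_le_of_le_iSup_fin (hn : 0 < n) (g : Fin n → ℝ) {r : ℝ} (h : r ≤ ⨆ i, g i) :
    ∃ i, r ≤ g i := by
  have : Nonempty (Fin n) := ⟨⟨0, hn⟩⟩
  obtain ⟨i, hi⟩ := exists_eq_ciSup_of_finite (f := g)
  exact ⟨i, hi ▸ h⟩

/-- An inequality between `c (θ x) * p` and `M` passes from levels `x < r` to the level `r`. -/
lemma ofReal_mul_le_of_forall_lt {c : ℝ → ℝ} (hc : Continuous c) {r θ : ℝ} (hr : 0 < r)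
    {p M : ℝ≥0∞} (hp : p ≠ ∞)
    (h : ∀ x, 0 < x → x < r → ENNReal.ofReal (c (θ * x)) * p ≤ M) :
    ENNReal.ofReal (c (θ * r)) * p ≤ M := by
  have hcont : Continuous fun x : ℝ => ENNReal.ofReal (c (θ * x)) * p :=
    ENNReal.continuous_mul_const hp |>.comp
      (ENNReal.continuous_ofReal.comp (hc.comp (continuous_const_mul θ)))
  refine le_of_tendsto (x := nhdsWithin r (Set.Iio r))
    ((hcont.tendsto r).mono_left nhdsWithin_le_nhds) ?_
  filter_upwards [Ioo_mem_nhdsLT hr] with x hx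
  exact h x hx.1 hx.2

end Convex

/-! ### Dense families of vectors and partial sums -/

section Sums

variable {𝕜 H Ω : Type*} [RCLike 𝕜] [NormedAddCommGroup H] [InnerProductSpace 𝕜 H]
  {n : ℕ} {X : Fin n → Ω → H →L[𝕜] H}

/-- A quadratic form exceeding a level at a unit vector does so at a member of a dense family. -/
lemma exists_denseRange_lt {H ι : Type*} [NormedAddCommGroup H] {v : ι → Metric.sphere (0 : H) 1}
    (hv : DenseRange v) {g : H → ℝ} (hg : Continuous g) {x : ℝ} {u : H} (hu : ‖u‖ = 1) (hx : x < g u) :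
    ∃ i, x < g (v i) := by
  have hopen : IsOpen {z : Metric.sphere (0 : H) 1 | x < g z} :=
    isOpen_lt continuous_const (hg.comp continuous_subtype_val)
  exact hv.exists_mem_open hopen ⟨⟨u, mem_sphere_zero_iff_norm.2 hu⟩, hx⟩

lemma isCompactOperator_sum {ι : Type*} {T : Finset ι} {A : ι → H →L[𝕜] H}
    (hA : ∀ i ∈ T, IsCompactOperator (A i)) : IsCompactOperator (∑ i ∈ T, A i : H →L[𝕜] H) := by
  have : (∑ i ∈ T, A i) ∈ compactOperator (RingHom.id 𝕜) H H := sum_mem fun i hi => hA i hi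
  exact this

lemma isCompactOperator_partialSum (hXcompact : ∀ i ω, IsCompactOperator (X i ω)) (i : Fin n)
    (ω : Ω) : IsCompactOperator (partialSum X i ω) :=
  isCompactOperator_sum fun j _ => hXcompact j ω

lemma isSelfAdjoint_partialSum [CompleteSpace H] (hXsa : ∀ i ω, IsSelfAdjoint (X i ω)) (i : Fin n)
    (ω : Ω) : IsSelfAdjoint (partialSum X i ω) :=
  isSelfAdjoint_sum _ fun j _ => hXsa j ω

end Sums

/-! ### Maximal inequalities for λ_max and the norm -/

section Deviation

variable {𝕜 H Ω K : Type*} [RCLike 𝕜] [NormedAddCommGroup H] [InnerProductSpace 𝕜 H]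
  [CompleteSpace H] [MeasurableSpace Ω] {μ : Measure Ω} [IsProbabilityMeasure μ]
  {n : ℕ} {X : Fin n → Ω → H →L[𝕜] H}

/-- First passage weights for the quadratic forms `s k * ⟪u k, S u k⟫` of random operators. -/
lemma exists_firstPassage_weights_trace [Countable K]
    (hXmeas : ∀ i, AEStronglyMeasurable (X i) μ) (hXsa : ∀ i ω, IsSelfAdjoint (X i ω))
    (hXcompact : ∀ i ω, IsCompactOperator (X i ω)) (hXindep : iIndepFun X μ)
    (hXcentered : ∀ i, IsCentered μ (X i)) (u : K → H) (hu : ∀ k, ‖u k‖ = 1) (s : K → ℝ) (x : ℝ) :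
    ∃ w : K → ℝ≥0∞,
      ∑' k, w k
        = μ {ω | ∃ i k, x ≤ s k * RCLike.re ⟪u k, partialSum X i ω (u k)⟫_𝕜} ∧
      ∀ (f : ℝ → ℝ) (θ : ℝ) (a c : K → ℝ), Continuous f → (∀ t, 0 ≤ f t) → θ ≠ 0 →
        (∀ k, 0 ≤ c k) → (∀ k t, a k + c k * (s k * t - x) ≤ f (θ * t)) →
        ∑' k, ENNReal.ofReal (a k) * w k
          ≤ ∫⁻ ω, posTrace 𝕜 (spectralMap f ((θ : 𝕜) • ∑ i, X i ω)) ∂μ := by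
  have hcont : ∀ k, Continuous fun A : H →L[𝕜] H => s k * RCLike.re ⟪u k, A (u k)⟫_𝕜 := by
    intro k
    have : Continuous fun A : H →L[𝕜] H => A (u k) :=
      (ContinuousLinearMap.apply 𝕜 H (u k)).continuous
    fun_prop
  have hint : ∀ k i, Integrable (fun ω => s k * RCLike.re ⟪u k, X i ω (u k)⟫_𝕜) μ := fun k i =>
    ((hXcentered i (u k) (u k)).1.re).const_mul _
  have hzero : ∀ k i, ∫ ω, s k * RCLike.re ⟪u k, X i ω (u k)⟫_𝕜 ∂μ = 0 := by
    intro k i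
    obtain ⟨h1, h2⟩ := hXcentered i (u k) (u k)
    rw [integral_const_mul, integral_re h1, h2]
    simp
  have hsum : ∀ (k : K) (T : Finset (Fin n)) (ω : Ω),
      ∑ j ∈ T, s k * RCLike.re ⟪u k, X j ω (u k)⟫_𝕜
        = s k * RCLike.re ⟪u k, (∑ j ∈ T, X j ω) (u k)⟫_𝕜 := by
    intro k T ω
    rw [sum_apply, inner_sum, map_sum, Finset.mul_sum]
  obtain ⟨w, hw, hbound⟩ := exists_firstPassage_weights_of_aemeasurable
    (fun i => (hXmeas i).aemeasurable) hXindep (fun k => (hcont k).measurable) hint hzero x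
  simp only [hsum] at hw hbound
  refine ⟨w, hw, fun f θ a c hf hf0 hθ hc hac => hbound a c _ hc fun k =>
    Filter.Eventually.of_forall fun ω => ?_⟩
  have hθ' : (θ : 𝕜) ≠ 0 := RCLike.ofReal_ne_zero.2 hθ
  have hsa : IsSelfAdjoint (∑ i, X i ω) :=
    isSelfAdjoint_sum _ fun i _ => hXsa i ω
  have hcp : IsCompactOperator (∑ i, X i ω : H →L[𝕜] H) :=
    isCompactOperator_sum fun i _ => hXcompact i ω
  have hsaθ : IsSelfAdjoint ((θ : 𝕜) • ∑ i, X i ω) :=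
    IsSelfAdjoint.smul (RCLike.conj_ofReal θ) hsa
  -- The minorant is rewritten in the spectral variable of θS_n instead of S_n.
  have hmin : ∀ t, (a k - c k * x) + (c k * s k / θ) * t ≤ f t := by
    intro t
    have h := hac k (t / θ)
    rw [mul_div_cancel₀ _ hθ] at h
    refine le_trans (le_of_eq ?_) h
    field_simp
    ring
  refine le_trans (ENNReal.ofReal_le_ofReal (le_of_eq ?_))
    (ofReal_affine_le_posTrace hf hf0 hsaθ (hcp.smul _) hmin (hu k))
  rw [smul_apply, inner_smul_right, RCLike.re_ofReal_mul]
  field_simp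
  ring

variable [TopologicalSpace.SeparableSpace H]

/-- Maximal inequality for the largest spectral point, from the trace of `phi`. -/
lemma phi_mul_measure_lambdaMax_le (hn : 0 < n)
    (hXmeas : ∀ i, AEStronglyMeasurable (X i) μ) (hXsa : ∀ i ω, IsSelfAdjoint (X i ω))
    (hXcompact : ∀ i ω, IsCompactOperator (X i ω)) (hXindep : iIndepFun X μ)
    (hXcentered : ∀ i, IsCentered μ (X i)) {θ r : ℝ} (hθ : 0 < θ) (hr : 0 < r) :
    ENNReal.ofReal (phi (θ * r)) * μ {ω | r ≤ ⨆ i : Fin n, lambdaMax (partialSum X i ω)}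
      ≤ ∫⁻ ω, posTrace 𝕜 (spectralMap phi ((θ : 𝕜) • ∑ i, X i ω)) ∂μ := by
  refine ofReal_mul_le_of_forall_lt continuous_phi hr (measure_ne_top _ _) fun x hx hxr => ?_
  obtain ⟨D, hDc, hD⟩ := TopologicalSpace.exists_countable_dense (Metric.sphere (0 : H) 1)
  have := hDc.to_subtype
  have hθx : 0 < θ * x := mul_pos hθ hx
  obtain ⟨w, hw, hbound⟩ := exists_firstPassage_weights_trace hXmeas hXsa hXcompact hXindep
    hXcentered (fun k : D => ((k : Metric.sphere (0 : H) 1) : H))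
    (fun k => mem_sphere_zero_iff_norm.1 k.1.2) (fun _ => 1) x
  -- The slope is that of the tangent to t ↦ φ(θt) at x.
  have h := hbound phi θ (fun _ => phi (θ * x)) (fun _ => θ * (Real.exp (θ * x) - 1))
    continuous_phi phi_nonneg hθ.ne'
    (fun _ => mul_nonneg hθ.le (sub_nonneg.2 (Real.one_le_exp hθx.le)))
    (fun _ t => by
      have := phi_tangent (θ * x) (θ * t)
      linarith)
  rw [ENNReal.tsum_mul_left, hw] at h
  refine le_trans (mul_le_mul_right (measure_mono fun ω hω => ?_) _) h
  obtain ⟨i, hi⟩ := exists_le_of_le_iSup_fin hn _ hω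
  obtain ⟨u, hu, hxu⟩ := exists_lt_re_inner_of_le_lambdaMax
    (isCompactOperator_partialSum hXcompact i ω) hx.le hxr hi
  obtain ⟨k, hk⟩ := exists_denseRange_lt hD.denseRange_val
    (continuous_re_inner_apply_self (partialSum X i ω)) hu hxu
  exact ⟨i, k, by simpa using hk.le⟩

/-- Maximal inequality for the norm, from the trace of `cosh - 1` or from the traces of `phi` at
both `θ` and `-θ`. -/
lemma coshPhi_mul_measure_norm_le (hn : 0 < n)
    (hXmeas : ∀ i, AEStronglyMeasurable (X i) μ) (hXsa : ∀ i ω, IsSelfAdjoint (X i ω))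
    (hXcompact : ∀ i ω, IsCompactOperator (X i ω)) (hXindep : iIndepFun X μ)
    (hXcentered : ∀ i, IsCentered μ (X i)) {θ r : ℝ} (hθ : 0 < θ) (hr : 0 < r) {M : ℝ≥0∞}
    (hM : ∫⁻ ω, posTrace 𝕜 (spectralMap coshPhi ((θ : 𝕜) • ∑ i, X i ω)) ∂μ ≤ M ∨
      (∫⁻ ω, posTrace 𝕜 (spectralMap phi ((θ : 𝕜) • ∑ i, X i ω)) ∂μ ≤ M ∧
        ∫⁻ ω, posTrace 𝕜 (spectralMap phi (((-θ : ℝ) : 𝕜) • ∑ i, X i ω)) ∂μ ≤ M)) :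
    ENNReal.ofReal (coshPhi (θ * r)) * μ {ω | r ≤ ⨆ i : Fin n, ‖partialSum X i ω‖} ≤ M := by
  refine ofReal_mul_le_of_forall_lt continuous_coshPhi hr (measure_ne_top _ _) fun x hx hxr => ?_
  obtain ⟨D, hDc, hD⟩ := TopologicalSpace.exists_countable_dense (Metric.sphere (0 : H) 1)
  have := hDc.to_subtype
  have hθx : 0 < θ * x := mul_pos hθ hx
  -- Doubling the index by a sign turns |⟨u, S_i u⟩| ≥ x into a one-sided passage.
  let s : D × Bool → ℝ := fun k => if k.2 then 1 else -1
  have hs : ∀ k, s k = 1 ∨ s k = -1 := by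
    rintro ⟨k, b⟩
    cases b <;> simp [s]
  obtain ⟨w, hw, hbound⟩ := exists_firstPassage_weights_trace hXmeas hXsa hXcompact hXindep
    hXcentered (fun k : D × Bool => ((k.1 : Metric.sphere (0 : H) 1) : H))
    (fun k => mem_sphere_zero_iff_norm.1 k.1.1.2) s x
  have hsub : {ω | r ≤ ⨆ i : Fin n, ‖partialSum X i ω‖} ⊆ {ω | ∃ i, ∃ k : D × Bool,
      x ≤ s k * RCLike.re ⟪((k.1 : Metric.sphere (0 : H) 1) : H), partialSum X i ω k.1⟫_𝕜} := by
    intro ω hω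
    obtain ⟨i, hi⟩ := exists_le_of_le_iSup_fin hn _ hω
    obtain ⟨u, hu, hxu⟩ := exists_lt_abs_re_inner_of_le_norm
      (isSelfAdjoint_partialSum hXsa i ω).isSymmetric hx.le hxr hi
    obtain ⟨k, hk⟩ := exists_denseRange_lt hD.denseRange_val
      (continuous_re_inner_apply_self (partialSum X i ω)).abs hu hxu
    rcases lt_abs.1 hk with h | h
    · exact ⟨i, (k, true), by simpa [s] using h.le⟩
    · exact ⟨i, (k, false), by simpa [s] using h.le⟩
  refine le_trans (mul_le_mul_right (measure_mono hsub) _) ?_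
  rw [← hw, ← ENNReal.tsum_mul_left]
  rcases hM with hM | ⟨hM1, hM2⟩
  · refine le_trans (hbound coshPhi θ (fun _ => coshPhi (θ * x))
      (fun _ => θ * Real.sinh (θ * x)) continuous_coshPhi coshPhi_nonneg hθ.ne'
      (fun _ => mul_nonneg hθ.le (Real.sinh_nonneg_iff.2 hθx.le)) fun k t => ?_) hM
    have h := coshPhi_tangent (θ * x) (θ * (s k * t))
    have h2 : coshPhi (θ * (s k * t)) = coshPhi (θ * t) := by
      rcases hs k with h' | h' <;> rw [h']
      · rw [one_mul]
      · rw [← coshPhi_neg]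
        ring_nf
    linarith
  · have hphi : ∀ η : ℝ, (η = θ ∨ η = -θ) →
        ∑' k, ENNReal.ofReal (phi (s k * η * x)) * w k
          ≤ ∫⁻ ω, posTrace 𝕜 (spectralMap phi ((η : 𝕜) • ∑ i, X i ω)) ∂μ := by
      intro η hη
      -- This is the tangent to t ↦ φ(ηt) at `s k * x`, written in the variable `s k * t` using (s
      -- k)² = 1. Its slope has the form v(exp(vx) - 1), nonnegative for either sign of v.
      refine hbound phi η (fun k => phi (s k * η * x))
        (fun k => s k * η * (Real.exp (s k * η * x) - 1)) continuous_phi phi_nonneg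
        (by rcases hη with rfl | rfl <;> simp [hθ.ne']) (fun k => ?_) fun k t => ?_
      · rcases le_total 0 (s k * η) with h | h
        · exact mul_nonneg h (sub_nonneg.2 (Real.one_le_exp (mul_nonneg h hx.le)))
        · exact mul_nonneg_of_nonpos_of_nonpos h
            (sub_nonpos.2 (Real.exp_le_one_iff.2 (mul_nonpos_of_nonpos_of_nonneg h hx.le)))
      · have h := phi_tangent (s k * η * x) (η * t)
        have h2 : s k * η * (Real.exp (s k * η * x) - 1) * (s k * t - x)
            = (Real.exp (s k * η * x) - 1) * (s k * s k * (η * t) - s k * η * x) := by ring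
        have h3 : s k * s k = 1 := by rcases hs k with h' | h' <;> simp [h']
        rw [h2, h3, one_mul]
        exact h
    -- The same weights occur at θ and at -θ, so the two bounds can be added term by term.
    have hadd := add_le_add ((hphi θ (.inl rfl)).trans hM1) ((hphi (-θ) (.inr rfl)).trans hM2)
    rw [← ENNReal.tsum_add, ← two_mul] at hadd
    have hterm : ∀ k, ENNReal.ofReal (phi (s k * θ * x)) * w k
        + ENNReal.ofReal (phi (s k * -θ * x)) * w k
          = 2 * (ENNReal.ofReal (coshPhi (θ * x)) * w k) := by
      intro k
      have h2 : phi (s k * θ * x) + phi (s k * -θ * x) = 2 * coshPhi (θ * x) := by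
        have h3 : s k * -θ * x = -(s k * θ * x) := by ring
        rw [h3, phi_add_phi_neg]
        rcases hs k with h' | h' <;> rw [h']
        · rw [one_mul]
        · rw [← coshPhi_neg]
          ring_nf
      rw [← add_mul, ← ENNReal.ofReal_add (phi_nonneg _) (phi_nonneg _), h2,
        ENNReal.ofReal_mul zero_le_two, ENNReal.ofReal_ofNat, mul_assoc]
    simp only [hterm] at hadd
    rw [ENNReal.tsum_mul_left] at hadd
    exact (ENNReal.mul_le_mul_iff_right two_ne_zero ENNReal.ofNat_ne_top).1 hadd

end Deviation
-- From the maximal inequalities to exponential bounds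
section Bounds

/-- If the bound q is at least 1 there is nothing to prove, and this covers x ≤ 0. Otherwise x ≤
exp(x - 1) gives q φ(x) ≥ q exp(x)(1 - 1/e) - q = d exp(a) - q, and q < 1 ≤ d. The constant e/(e-1)
is the maximum of exp(x)/(exp(x) - x), attained at x = 1. -/
lemma le_mul_exp_of_phi_mul_le {p d a x : ℝ} (hp : p ≤ 1) (hd : 1 ≤ d) (ha : 0 ≤ a)
    (h : 0 < x → phi x * p ≤ d * (Real.exp a - 1)) :
    p ≤ Real.exp 1 / (Real.exp 1 - 1) * d * Real.exp (a - x) := by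
  have he : 0 < Real.exp 1 - 1 := sub_pos.2 (Real.one_lt_exp_iff.2 one_pos)
  have hC : 1 < Real.exp 1 / (Real.exp 1 - 1) := by
    rw [lt_div_iff₀ he]
    linarith
  set q := Real.exp 1 / (Real.exp 1 - 1) * d * Real.exp (a - x) with hq
  rcases le_or_gt 1 q with hq1 | hq1
  · exact hp.trans hq1
  have hCd : 1 < Real.exp 1 / (Real.exp 1 - 1) * d := by nlinarith
  have hq0 : 0 < q := mul_pos (by linarith) (Real.exp_pos _)
  have hx : 0 < x := by
    by_contra! hx
    have : 1 ≤ Real.exp (a - x) := Real.one_le_exp (by linarith)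
    nlinarith
  have hphi : 0 < phi x := by
    have := Real.add_one_lt_exp hx.ne'
    unfold phi
    linarith
  refine le_of_mul_le_mul_left ((h hx).trans ?_) hphi
  have h1 : q * Real.exp x = Real.exp 1 / (Real.exp 1 - 1) * d * Real.exp a := by
    rw [hq, mul_assoc, ← Real.exp_add, sub_add_cancel]
  have h2 : q * Real.exp (x - 1) = q * Real.exp x - d * Real.exp a := by
    have h3 : q * Real.exp (x - 1) = q * Real.exp x / Real.exp 1 := by
      rw [Real.exp_sub, mul_div_assoc]
    rw [h3, h1]
    field_simp
    ring
  have h4 : q * x ≤ q * Real.exp (x - 1) := by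
    have := Real.add_one_le_exp (x - 1)
    exact mul_le_mul_of_nonneg_left (by linarith) hq0.le
  unfold phi
  nlinarith

lemma le_mul_exp_of_coshPhi_mul_le {p d a x : ℝ} (hp : p ≤ 1) (hd : 1 ≤ d) (ha : 0 ≤ a)
    (h : 0 < x → coshPhi x * p ≤ d * (Real.exp a - 1)) :
    p ≤ 2 * d * Real.exp (a - x) := by
  set q := 2 * d * Real.exp (a - x) with hq
  rcases le_or_gt 1 q with hq1 | hq1
  · exact hp.trans hq1
  have hq0 : 0 < q := mul_pos (by linarith) (Real.exp_pos _)
  have hx : 0 < x := by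
    by_contra! hx
    have : 1 ≤ Real.exp (a - x) := Real.one_le_exp (by linarith)
    nlinarith
  have hcosh : 0 < coshPhi x := sub_pos.2 (Real.one_lt_cosh.2 hx.ne')
  refine le_of_mul_le_mul_left ((h hx).trans ?_) hcosh
  have h1 : q * Real.exp x = 2 * d * Real.exp a := by
    rw [hq, mul_assoc, ← Real.exp_add, sub_add_cancel]
  -- Dropping this term leaves q(cosh x - 1) ≥ d exp(a) - q, with q < 1 ≤ d.
  have h2 : 0 < q * Real.exp (-x) := mul_pos hq0 (Real.exp_pos _)
  rw [coshPhi, Real.cosh_eq]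
  nlinarith

lemma mul_le_of_add_ofReal_le {c d B : ℝ} {T m : ℝ≥0∞} (hc : 0 ≤ c) (hd : 0 ≤ d) (hB : 0 ≤ B)
    (hT : T + ENNReal.ofReal d ≤ ENNReal.ofReal (d * B)) (hm : m ≠ ∞)
    (h : ENNReal.ofReal c * m ≤ T) : c * m.toReal ≤ d * (B - 1) := by
  have h1 := (add_le_add_left h (ENNReal.ofReal d)).trans hT
  rw [← ENNReal.ofReal_toReal hm, ← ENNReal.ofReal_mul hc,
    ← ENNReal.ofReal_add (mul_nonneg hc ENNReal.toReal_nonneg) hd] at h1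
  have := (ENNReal.ofReal_le_ofReal_iff (mul_nonneg hd hB)).1 h1
  linarith

/-- The trace is nonnegative, so the trace bound itself forces ψσ² ≥ 0. -/
lemma nonneg_of_add_ofReal_le {d a : ℝ} {T : ℝ≥0∞} (hd : 0 < d)
    (hT : T + ENNReal.ofReal d ≤ ENNReal.ofReal (d * Real.exp a)) : 0 ≤ a := by
  have h1 := le_add_self.trans hT
  rw [ENNReal.ofReal_le_ofReal_iff (mul_pos hd (Real.exp_pos a)).le] at h1
  exact Real.one_le_exp_iff.1 (le_of_mul_le_mul_left (by linarith) hd)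

lemma le_mul_iInf_exp {C p : ℝ} (hC : 0 ≤ C) {θmax : EReal} (hθmax : 0 < θmax) {g : ℝ → ℝ}
    (h : ∀ θ : ℝ, 0 ≤ θ → (θ : EReal) < θmax → p ≤ C * g θ) :
    p ≤ C * ⨅ θ : {θ : ℝ // 0 ≤ θ ∧ (θ : EReal) < θmax}, g θ := by
  have : Nonempty {θ : ℝ // 0 ≤ θ ∧ (θ : EReal) < θmax} := ⟨⟨0, le_rfl, by simpa using hθmax⟩⟩
  rw [Real.mul_iInf_of_nonneg hC]
  exact le_ciInf fun θ => h θ θ.2.1 θ.2.2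

end Bounds

theorem theorem1 {𝕜 H Ω : Type*} [RCLike 𝕜]
    [NormedAddCommGroup H] [InnerProductSpace 𝕜 H] [CompleteSpace H]
    [TopologicalSpace.SeparableSpace H]
    [MeasurableSpace Ω] (μ : Measure Ω) [IsProbabilityMeasure μ]
    (n : ℕ) (hn : 0 < n) (X : Fin n → Ω → H →L[𝕜] H)
    (hXmeas : ∀ i, AEStronglyMeasurable (X i) μ)
    (hXsa : ∀ i ω, IsSelfAdjoint (X i ω))
    (hXcompact : ∀ i ω, IsCompactOperator (X i ω))
    (hXindep : iIndepFun X μ)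
    (hXcentered : ∀ i, IsCentered μ (X i))
    (ψ : ℝ → ℝ) (θmax : EReal) (hθmax : 0 < θmax)
    (σ d' r : ℝ) (hσ : 0 < σ) (hd' : 1 ≤ d') :
    ((∀ θ : ℝ, 0 ≤ θ → (θ : EReal) < θmax →
        TraceBound μ phi (fun ω => ∑ i, X i ω) ψ σ d' θ) →
      μ.real {ω | r ≤ ⨆ i : Fin n, lambdaMax (partialSum X i ω)} ≤
        Real.exp 1 / (Real.exp 1 - 1) * d' *
          ⨅ θ : {θ : ℝ // 0 ≤ θ ∧ (θ : EReal) < θmax}, Real.exp (ψ θ * σ ^ 2 - θ * r)) ∧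
    (((∀ θ : ℝ, -θmax < (θ : EReal) → (θ : EReal) < θmax →
          TraceBound μ phi (fun ω => ∑ i, X i ω) ψ σ d' θ) ∨
        (∀ θ : ℝ, 0 ≤ θ → (θ : EReal) < θmax →
          TraceBound μ coshPhi (fun ω => ∑ i, X i ω) ψ σ d' θ)) →
      μ.real {ω | r ≤ ⨆ i : Fin n, ‖partialSum X i ω‖} ≤
        2 * d' *
          ⨅ θ : {θ : ℝ // 0 ≤ θ ∧ (θ : EReal) < θmax}, Real.exp (ψ θ * σ ^ 2 - θ * r)) := by
  have hpos : ∀ {θ : ℝ}, 0 ≤ θ → 0 < θ * r → 0 < θ ∧ 0 < r := by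
    intro θ hθ h
    have hθ0 : 0 < θ := lt_of_le_of_ne hθ (by rintro rfl; simp at h)
    exact ⟨hθ0, (mul_pos_iff_of_pos_left hθ0).1 h⟩
  refine ⟨fun hT => le_mul_iInf_exp (g := fun θ => Real.exp (ψ θ * σ ^ 2 - θ * r)) ?_ hθmax
      fun θ hθ hθlt => ?_,
    fun hT => le_mul_iInf_exp (g := fun θ => Real.exp (ψ θ * σ ^ 2 - θ * r)) ?_ hθmax
      fun θ hθ hθlt => ?_⟩
  · have := Real.one_lt_exp_iff.2 one_pos
    exact mul_nonneg (div_nonneg (Real.exp_pos _).le (by linarith)) (by linarith)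
  · have hB := hT θ hθ hθlt
    rw [TraceBound, abs_of_nonneg hθ] at hB
    refine le_mul_exp_of_phi_mul_le measureReal_le_one hd'
      (nonneg_of_add_ofReal_le (by linarith) hB) fun hx => ?_
    obtain ⟨hθ0, hr⟩ := hpos hθ hx
    exact mul_le_of_add_ofReal_le (phi_nonneg _) (by linarith) (Real.exp_pos _).le hB
      (measure_ne_top _ _)
      (phi_mul_measure_lambdaMax_le hn hXmeas hXsa hXcompact hXindep hXcentered hθ0 hr)
  · linarith
  · obtain ⟨M, hB, hM⟩ : ∃ M : ℝ≥0∞,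
        M + ENNReal.ofReal d' ≤ ENNReal.ofReal (d' * Real.exp (ψ θ * σ ^ 2)) ∧
        (∫⁻ ω, posTrace 𝕜 (spectralMap coshPhi ((θ : 𝕜) • ∑ i, X i ω)) ∂μ ≤ M ∨
          (∫⁻ ω, posTrace 𝕜 (spectralMap phi ((θ : 𝕜) • ∑ i, X i ω)) ∂μ ≤ M ∧
            ∫⁻ ω, posTrace 𝕜 (spectralMap phi (((-θ : ℝ) : 𝕜) • ∑ i, X i ω)) ∂μ ≤ M)) := by
      rcases hT with hT | hT
      · have h1 := hT θ (lt_of_lt_of_le (by rw [EReal.neg_lt_comm]; simpa using hθmax)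
          (by exact_mod_cast hθ : (0 : EReal) ≤ θ)) hθlt
        have h2 := hT (-θ) (by rw [EReal.coe_neg]; exact EReal.neg_lt_neg_iff.2 hθlt)
          (lt_of_le_of_lt (by exact_mod_cast (by linarith : -θ ≤ 0)) hθmax)
        rw [TraceBound, abs_of_nonneg hθ] at h1
        rw [TraceBound, abs_neg, abs_of_nonneg hθ] at h2
        -- The bound sees only |θ|, so the larger of the two expected traces satisfies it too.
        refine ⟨_, ?_, .inr ⟨le_max_left _ _, le_max_right _ _⟩⟩
        rw [max_add]
        exact max_le h1 h2
      · have h1 := hT θ hθ hθlt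
        rw [TraceBound, abs_of_nonneg hθ] at h1
        exact ⟨_, h1, .inl le_rfl⟩
    refine le_mul_exp_of_coshPhi_mul_le measureReal_le_one hd'
      (nonneg_of_add_ofReal_le (by linarith) hB) fun hx => ?_
    obtain ⟨hθ0, hr⟩ := hpos hθ hx
    exact mul_le_of_add_ofReal_le (coshPhi_nonneg _) (by linarith) (Real.exp_pos _).le hB
      (measure_ne_top _ _)
      (coshPhi_mul_measure_norm_le hn hXmeas hXsa hXcompact hXindep hXcentered hθ0 hr hM)
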